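/- **Theorem 5.4.** Let $\mathscr{A}$ be a (not necessarily unital) complex $^*$-algebra. A linear functional $h:\mathscr{A}\to\mathbb{C}$ is called *representable* if there are a Hilbert space $H$, a $^*$-homomorphism $\pi:\mathscr{A}\to\mathscr{B}(H)$ and a vector $\xi\in H$ with $h(a)=\langle \pi(a)\xi,\xi\rangle$ for all $a\in\mathscr{A}$. Let $\mathscr{A}^{\sharp}$ denote the set of representable functionals on $\mathscr{A}$, (partially) ordered by $h\leq k$ if and only if $(k-h)(a^*a)\geq 0$ for all $a\in\mathscr{A}$; for $h,k\in\mathscr{A}^\sharp$ put $[h,k]=\{\widetilde f\in\mathscr{A}^\sharp: h\leq \widetilde f\leq k\}$. Let $\mathscr{I}\subseteq\mathscr{A}$ be a left ideal and let $f:\mathscr{I}\to\mathbb{C}$ be a linear functional that is *Hilbert bounded*, i.e. there is $M\geq 0$ with $|f(a)|^2\leq M f(a^*a)$ for all $a\in\mathscr{I}$, and *admissible*, i.e. for every $x\in\mathscr{A}$ there is $\lambda_x\geq 0$ with $f(a^*x^*xa)\leq\lambda_x f(a^*a)$ for all $a\in\mathscr{I}$. For a linear functional $h$ on $\mathscr{I}$,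 let $h_N$ denote the smallest element of the set of representable extensions of $h$ to $\mathscr{A}$, if there is one. Then $f_N$ exists. Let $g\in\mathscr{A}^\sharp$ be such that $f_N\leq g$. Then $(g-f)_N$ exists as well, where $g-f$ is the functional $a\mapsto g(a)-f(a)$ on $\mathscr{I}$; the functional $$f^g_{max}:=g-(g-f)_N$$ is representable, and it is the largest representable extension of $f$ that lies below $g$: $$f^g_{max}=\max\{\widetilde f\in\mathscr{A}^\sharp:\ \widetilde f\leq g,\ f\subset\widetilde f\}.$$ Furthermore, the representable extensions of $f$ below $g$ are exactly the representable functionals between $f_N$ and $f^g_{max}$: $$[f_N,f^g_{max}]=\{\widetilde f\in\mathscr{A}^\sharp:\ \widetilde f\leq g,\ f\subset\widetilde f\}.$$ -/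

import Mathlib

open scoped ComplexOrder

universe u

noncomputable section

namespace StarAlg

section Basic

variable {A : Type u} [NonUnitalRing A] [StarRing A] [Module ℂ A]

/-- A linear functional `f` on the complex star-algebra `A` is representable if there are a Hilbert
space `H`, a star-homomorphism `π` from `A` to the bounded operators on `H`, and a vector `ξ` with
`f a = ⟨π a ξ, ξ⟩`. Mathlib's inner product is linear in the second variable. A Hilbert space in the
universe of `A` can always be found, as the GNS space is a completion of a quotient of `A`. -/
def IsRepresentable (f : A →ₗ[ℂ] ℂ) : Prop :=
  ∃ (H : Type u) (_ : NormedAddCommGroup H) (_ : InnerProductSpace ℂ H) (_ : CompleteSpace H)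
    (π : A →⋆ₙₐ[ℂ] (H →L[ℂ] H)) (ξ : H), ∀ a : A, f a = inner ℂ ξ (π a ξ)

variable (A) in
/-- The set of representable functionals on `A`, as a type. -/
def Rep : Type u := {f : A →ₗ[ℂ] ℂ // IsRepresentable f}

/-- The functional underlying a representable functional. -/
def Rep.toFun (F : Rep A) : A →ₗ[ℂ] ℂ := F.1

theorem Rep.ext {F G : Rep A} (h : F.toFun = G.toFun) : F = G := Subtype.ext h

/-- A functional `f` on `A` is positive if `f (a⋆ a)` is real and nonnegative for all `a`. -/
def IsPositive (f : A →ₗ[ℂ] ℂ) : Prop := ∀ a : A, 0 ≤ f (star a * a)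

theorem isRepresentable_zero : IsRepresentable (0 : A →ₗ[ℂ] ℂ) :=
  ⟨EuclideanSpace ℂ PEmpty.{u + 1}, inferInstance, inferInstance, inferInstance, 0, 0, by simp⟩

instance : Inhabited (Rep A) := ⟨⟨0, isRepresentable_zero⟩⟩

end Basic

section Order

variable {A : Type u} [NonUnitalRing A] [StarRing A] [Module ℂ A]
  [IsScalarTower ℂ A A] [SMulCommClass ℂ A A] [StarModule ℂ A]

/-- Polarization: a functional that vanishes on all `a⋆ a` vanishes on all products. -/
theorem eq_zero_on_mul (D : A →ₗ[ℂ] ℂ) (h : ∀ a, D (star a * a) = 0) (a b : A) :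
    D (a * b) = 0 := by
  have key : ∀ x y : A, D (star x * y) = 0 := by
    intro x y
    have h1 := h (x + y)
    have h2 := h (x + Complex.I • y)
    simp only [star_add, star_smul, add_mul, mul_add, smul_mul_assoc, mul_smul_comm, map_add,
      map_smul, h, smul_eq_mul, RCLike.star_def, Complex.conj_I] at h1 h2
    have h3 : Complex.I * (D (star x * y) - D (star y * x)) = 0 := by linear_combination h2
    have h4 := (mul_eq_zero.1 h3).resolve_left Complex.I_ne_zero
    linear_combination (h1 + h4) / 2
  simpa using key (star a) b

/-- Two representable functionals that agree on products agree. -/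
theorem eq_of_eq_on_mul {f g : A →ₗ[ℂ] ℂ} (hf : IsRepresentable f) (hg : IsRepresentable g)
    (h : ∀ a b : A, f (a * b) = g (a * b)) : f = g := by
  obtain ⟨H, _, _, _, π, ξ, hf⟩ := hf
  obtain ⟨H', _, _, _, ρ, η, hg⟩ := hg
  have adj1 : ∀ a x y, inner ℂ (π a x) y = inner ℂ x (π (star a) y) := fun a x y => by
    rw [map_star, ContinuousLinearMap.star_eq_adjoint, ContinuousLinearMap.adjoint_inner_right]
  have adj2 : ∀ a x y, inner ℂ (ρ a x) y = inner ℂ x (ρ (star a) y) := fun a x y => by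
    rw [map_star, ContinuousLinearMap.star_eq_adjoint, ContinuousLinearMap.adjoint_inner_right]
  let e := WithLp.prodContinuousLinearEquiv 2 ℂ H H'
  let P : A → (WithLp 2 (H × H') →L[ℂ] WithLp 2 (H × H')) := fun a =>
    (e.symm : _ →L[ℂ] _).comp (((π a).prodMap (ρ a)).comp (e : _ →L[ℂ] _))
  have P1 : ∀ a x, (P a x).fst = π a x.fst := fun a x => rfl
  have P2 : ∀ a x, (P a x).snd = ρ a x.snd := fun a x => rfl
  have adj : ∀ a x y, inner ℂ (P a x) y = inner ℂ x (P (star a) y) := fun a x y => by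
    simp only [WithLp.prod_inner_apply]
    exact congrArg₂ (· + ·) (adj1 a _ _) (adj2 a _ _)
  have hext : ∀ x y : WithLp 2 (H × H'), x.fst = y.fst → x.snd = y.snd → x = y :=
    fun x y h1 h2 => WithLp.ofLp_injective 2 (Prod.ext h1 h2)
  have Pmul : ∀ a b x, P (a * b) x = P a (P b x) := fun a b x =>
    hext _ _ (by simp only [P1, map_mul, ContinuousLinearMap.mul_apply])
      (by simp only [P2, map_mul, ContinuousLinearMap.mul_apply])
  let ζ : WithLp 2 (H × H') := WithLp.toLp 2 (ξ, η)
  let ζ' : WithLp 2 (H × H') := WithLp.toLp 2 (ξ, -η)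
  let L : A →ₗ[ℂ] WithLp 2 (H × H') :=
    { toFun := fun a => P a ζ
      map_add' := fun a b => hext _ _
        (by simp only [P1, map_add, WithLp.add_fst, ContinuousLinearMap.add_apply])
        (by simp only [P2, map_add, WithLp.add_snd, ContinuousLinearMap.add_apply])
      map_smul' := fun c a => hext _ _
        (by simp only [P1, map_smul, WithLp.smul_fst, ContinuousLinearMap.smul_apply,
          RingHom.id_apply])
        (by simp only [P2, map_smul, WithLp.smul_snd, ContinuousLinearMap.smul_apply,
          RingHom.id_apply]) }
  have LP : ∀ a, L a = P a ζ := fun a => rfl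
  let K := (LinearMap.range L).topologicalClosure
  have : CompleteSpace K := (LinearMap.range L).isClosed_topologicalClosure.completeSpace_coe
  have hD : ∀ a, inner ℂ ζ' (P a ζ) = f a - g a := fun a => by
    simp only [WithLp.prod_inner_apply, hf, hg]
    change inner ℂ ξ (π a ξ) + inner ℂ (-η) (ρ a η) = _
    rw [inner_neg_left, sub_eq_add_neg]
  have inv : ∀ a, ∀ k ∈ K, P a k ∈ K := fun a k hk => by
    refine map_mem_closure (P a).continuous hk ?_
    rintro _ ⟨b, rfl⟩
    exact ⟨a * b, by rw [LP, LP, Pmul]⟩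
  obtain ⟨k, hk, z, hz, hkz⟩ := K.exists_add_mem_mem_orthogonal ζ
  have Lmem : ∀ b, P b ζ ∈ K := fun b => subset_closure ⟨b, rfl⟩
  have Pz : ∀ a, P a z = 0 := fun a => by
    have m1 : P a z ∈ K := by
      have : P a z = P a ζ - P a k := by rw [hkz, map_add]; abel
      rw [this]
      exact K.sub_mem (Lmem a) (inv a k hk)
    have m2 : P a z ∈ Kᗮ := fun u hu => by
      have := adj (star a) u z
      rw [star_star] at this
      rw [← this]
      exact hz _ (inv _ u hu)
    exact inner_self_eq_zero.1 (m2 _ m1)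
  ext a
  refine sub_eq_zero.1 ?_
  rw [← hD a, hkz, map_add, Pz, add_zero]
  have hc : IsClosed {k | inner ℂ ζ' (P a k) = 0} :=
    isClosed_eq (by fun_prop) continuous_const
  refine closure_minimal ?_ hc hk
  rintro _ ⟨b, rfl⟩
  change inner ℂ ζ' (P a (P b ζ)) = 0
  rw [← Pmul, hD, h, sub_self]

/-- The order of representable functionals: `F ≤ G` means that `G - F` is positive. -/
instance : PartialOrder (Rep A) where
  le F G := IsPositive (G.toFun - F.toFun)
  le_refl F a := by simp
  le_trans F G K h1 h2 a := by
    have := add_nonneg (h1 a) (h2 a)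
    simpa using this
  le_antisymm F G h1 h2 := by
    refine Rep.ext (eq_of_eq_on_mul F.2 G.2 fun a b => ?_)
    refine sub_eq_zero.1 (eq_zero_on_mul (F.toFun - G.toFun) (fun c => ?_) a b)
    refine le_antisymm ?_ (h2 c)
    have := h1 c
    rw [← neg_sub, LinearMap.neg_apply] at this
    exact neg_nonneg.1 this

end Order

section Ideal

/-- A left ideal of the complex algebra `A`: a linear subspace closed under multiplication by
elements of `A` from the left. -/
structure LeftIdeal (A : Type u) [NonUnitalRing A] [Module ℂ A] extends Submodule ℂ A where
  mul_mem_left' : ∀ (x : A) {a : A}, a ∈ carrier → x * a ∈ carrier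

variable {A : Type u} [NonUnitalRing A] [Module ℂ A]

/-- The product `x a`, for `x` in `A` and `a` in the left ideal, as an element of the ideal. -/
def LeftIdeal.lmul (I : LeftIdeal A) (x : A) (a : I.toSubmodule) : I.toSubmodule :=
  ⟨x * (a : A), I.mul_mem_left' x a.2⟩

variable [StarRing A] {I : LeftIdeal A}

/-- `|f a|² ≤ M f (a⋆ a)` on the ideal, for some constant `M ≥ 0`. The inequality between complex
numbers says in particular that the right-hand side is real. -/
def IsHilbertBounded (f : I.toSubmodule →ₗ[ℂ] ℂ) : Prop :=
  ∃ M : ℝ, 0 ≤ M ∧ ∀ a : I.toSubmodule,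
    ((‖f a‖ ^ 2 : ℝ) : ℂ) ≤ (M : ℂ) * f (I.lmul (star (a : A)) a)

/-- For each `x` in `A` there is `c ≥ 0` with `f (a⋆ x⋆ x a) ≤ c f (a⋆ a)` on the ideal. -/
def IsAdmissible (f : I.toSubmodule →ₗ[ℂ] ℂ) : Prop :=
  ∀ x : A, ∃ c : ℝ, 0 ≤ c ∧ ∀ a : I.toSubmodule,
    f (I.lmul (star (a : A) * star x * x) a) ≤ (c : ℂ) * f (I.lmul (star (a : A)) a)

/-- The representable extensions of `f` to the whole algebra. -/
def repExtensions (f : I.toSubmodule →ₗ[ℂ] ℂ) : Set (Rep A) :=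
  {F | ∀ a : I.toSubmodule, F.toFun (a : A) = f a}

variable [IsScalarTower ℂ A A] [SMulCommClass ℂ A A] [StarModule ℂ A]

open Classical in
/-- The Krein-von Neumann extension of `f`: the smallest representable extension of `f`. It is
unique as the order is antisymmetric; the value is a dummy one if there is no such extension. -/
def kreinVonNeumann (f : I.toSubmodule →ₗ[ℂ] ℂ) : Rep A :=
  if h : ∃ F, IsLeast (repExtensions f) F then h.choose else default

end Ideal

end StarAlg

end

noncomputable section

namespace StarAlg

open scoped InnerProductSpace
open UniformSpace Filter Topology

/-! The map `F ↦ g - F` reverses order and exchanges the representable extensions of `f` below `g`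
with those of `g - f` below `g`, so a smallest one on the second side gives a largest one on the
first. Two facts carry this.

Existence of the smallest extension (`exists_isLeast_repExtensions`): complete `I` under `f (a⋆ b)`.
Admissibility makes left multiplication bounded, Hilbert boundedness makes `f` a bounded functional
with Riesz vector `ζ`, and `⟪ζ, π x ζ⟫` is the smallest extension.

Differences (`isRepresentable_sub`): if `F ≤ G` are representable, so is `G - F`. Admissibility
follows from Cauchy-Schwarz along the powers of `x⋆ x`, Hilbert boundedness by approximating the
cyclic vector of `G`. Hence `g - f` is the restriction of the representable `g - f_N`, and `(g -
f)_N` exists.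

An intermediate functional extends `f` because its difference from `f_N` vanishes at every `a⋆ a`
with `a` in `I`, hence on `I` by Hilbert boundedness. -/

/-- A log-convex nonnegative sequence of growth at most `C * c ^ n` satisfies `q 1 ≤ c * q 0`. -/
theorem le_mul_of_logConvex_of_growth {q : ℕ → ℝ} {C c : ℝ} (hc : 0 < c) (hq : ∀ n, 0 ≤ q n)
    (hlog : ∀ n, q (n + 1) ^ 2 ≤ q n * q (n + 2)) (hC : ∀ n, q n ≤ C * c ^ n) :
    q 1 ≤ c * q 0 := by
  by_contra! hlt
  have h0 : 0 < q 0 := by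
    rcases (hq 0).eq_or_lt with h | h
    · have := hlog 0
      rw [← h] at this hlt
      nlinarith
    · exact h
  obtain ⟨r, hr⟩ : ∃ r, r = q 1 / q 0 := ⟨_, rfl⟩
  have hrc : c < r := by rw [hr, lt_div_iff₀ h0]; exact hlt
  have hr0 : 0 < r := hc.trans hrc
  -- Log-convexity makes the ratios `q (n + 1) / q n` nondecreasing, so all are at least `r`. Then
  -- `q n` is at least `r ^ n * q 0`, which outgrows `C * c ^ n`.
  have step : ∀ n, 0 < q n ∧ r * q n ≤ q (n + 1) := by
    intro n
    induction n with
    | zero => exact ⟨h0, by rw [hr, div_mul_cancel₀ _ h0.ne']⟩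
    | succ n ih =>
      obtain ⟨h1, h2⟩ := ih
      have h3 : 0 < q (n + 1) := lt_of_lt_of_le (mul_pos hr0 h1) h2
      refine ⟨h3, ?_⟩
      have h4 := hlog n
      refine le_of_mul_le_mul_left ?_ h1
      nlinarith
  have low : ∀ n, r ^ n * q 0 ≤ q n := by
    intro n
    induction n with
    | zero => simp
    | succ n ih =>
      have := (step n).2
      rw [pow_succ']
      nlinarith
  have ht : Tendsto (fun n : ℕ => (r / c) ^ n) atTop atTop :=
    tendsto_pow_atTop_atTop_of_one_lt ((one_lt_div hc).2 hrc)
  obtain ⟨n, hn⟩ := (ht.eventually_gt_atTop (C / q 0)).exists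
  rw [div_pow, div_lt_div_iff₀ h0 (pow_pos hc n)] at hn
  exact absurd ((low n).trans (hC n)) (not_le.2 hn)

/-! ### Representations on completions -/

section Completion

variable {A : Type u} [NonUnitalRing A] [StarRing A] [Module ℂ A]

/-- An action of `A` by bounded operators on a pre-Hilbert space in which `star x` acts as a formal
adjoint of `x` extends to a star-representation on the completion. -/
theorem exists_starHom_completion {E : Type u} [SeminormedAddCommGroup E] [InnerProductSpace ℂ E]
    (L : A → E →ₗ[ℂ] E) (hadd : ∀ x y a, L (x + y) a = L x a + L y a)
    (hsmul : ∀ (c : ℂ) x a, L (c • x) a = c • L x a) (hmul : ∀ x y a, L (x * y) a = L x (L y a))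
    (hstar : ∀ x a b, ⟪L (star x) a, b⟫_ℂ = ⟪a, L x b⟫_ℂ)
    (hbd : ∀ x, ∃ C : ℝ, ∀ a, ‖L x a‖ ≤ C * ‖a‖) :
    ∃ π : A →⋆ₙₐ[ℂ] (Completion E →L[ℂ] Completion E),
      ∀ x (a : E), π x (a : Completion E) = (L x a : Completion E) := by
  choose C hC using hbd
  let T : A → E →L[ℂ] E := fun x => (L x).mkContinuous (C x) (hC x)
  have hT : ∀ x (a : E), (T x).completion (a : Completion E) = (L x a : Completion E) :=
    fun x a => by simp [T]
  have hext : ∀ S S' : Completion E →L[ℂ] Completion E, (∀ a : E, S a = S' a) → S = S' := by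
    intro S S' h
    ext c
    induction c using Completion.induction_on with
    | hp => apply isClosed_eq <;> fun_prop
    | ih c => exact h c
  have hs : ∀ (c : ℂ) x, (T (c • x)).completion = c • (T x).completion := fun c x =>
    hext _ _ fun a => by
      rw [smul_apply, hT, hT, hsmul, Completion.coe_smul]
  exact ⟨{
    toFun := fun x => (T x).completion
    map_smul' := hs
    map_zero' := by simpa using hs 0 0
    map_add' := fun x y => hext _ _ fun a => by
      rw [add_apply, hT, hT, hT, hadd, Completion.coe_add]
    map_mul' := fun x y => hext _ _ fun a => by
      rw [mul_apply_eq_comp, hT, hT, hT, hmul]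
    map_star' := fun x => by
      refine (ContinuousLinearMap.eq_adjoint_iff (T (star x)).completion
        (T x).completion).mpr fun a b => ?_
      induction a, b using Completion.induction_on₂ with
      | hp => apply isClosed_eq <;> fun_prop
      | ih a b => rw [hT, hT, Completion.inner_coe, Completion.inner_coe, hstar] }, hT⟩

end Completion

/-! ### Properties of representable functionals -/

section Representable

variable {A : Type u} [NonUnitalRing A] [StarRing A] [Module ℂ A]

theorem inner_starHom_left {H : Type*} [NormedAddCommGroup H] [InnerProductSpace ℂ H]
    [CompleteSpace H] (π : A →⋆ₙₐ[ℂ] (H →L[ℂ] H)) (a : A) (x y : H) :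
    ⟪π (star a) x, y⟫_ℂ = ⟪x, π a y⟫_ℂ := by
  rw [map_star, ContinuousLinearMap.star_eq_adjoint, ContinuousLinearMap.adjoint_inner_left]

theorem inner_starHom_mul {H : Type*} [NormedAddCommGroup H] [InnerProductSpace ℂ H]
    [CompleteSpace H] (π : A →⋆ₙₐ[ℂ] (H →L[ℂ] H)) (a b : A) (x y : H) :
    ⟪x, π (star a * b) y⟫_ℂ = ⟪π a x, π b y⟫_ℂ := by
  rw [map_mul, mul_apply_eq_comp, ← inner_starHom_left, star_star]

theorem inner_starHom_star_mul_self {H : Type*} [NormedAddCommGroup H] [InnerProductSpace ℂ H]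
    [CompleteSpace H] (π : A →⋆ₙₐ[ℂ] (H →L[ℂ] H)) (a : A) (x : H) :
    ⟪x, π (star a * a) x⟫_ℂ = ((‖π a x‖ ^ 2 : ℝ) : ℂ) := by
  rw [inner_starHom_mul, inner_self_eq_norm_sq_to_K]
  norm_cast

/-- The representing vector can be chosen in the closure of its orbit. -/
theorem IsRepresentable.exists_cyclic {f : A →ₗ[ℂ] ℂ} (hf : IsRepresentable f) :
    ∃ (H : Type u) (_ : NormedAddCommGroup H) (_ : InnerProductSpace ℂ H) (_ : CompleteSpace H)
      (π : A →⋆ₙₐ[ℂ] (H →L[ℂ] H)) (ξ : H), (∀ a : A, f a = ⟪ξ, π a ξ⟫_ℂ) ∧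
      ξ ∈ closure (Set.range fun a => π a ξ) := by
  obtain ⟨H, _, _, _, π, ξ, hf⟩ := hf
  let L : A →ₗ[ℂ] H :=
    { toFun := fun a => π a ξ
      map_add' := fun a b => by rw [map_add, add_apply]
      map_smul' := fun c a => by rw [map_smul, smul_apply, RingHom.id_apply] }
  let K := (LinearMap.range L).topologicalClosure
  have : CompleteSpace K := (LinearMap.range L).isClosed_topologicalClosure.completeSpace_coe
  have Lmem : ∀ b, π b ξ ∈ K := fun b => subset_closure ⟨b, rfl⟩
  have inv : ∀ a, ∀ k ∈ K, π a k ∈ K := fun a k hk => by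
    refine map_mem_closure (π a).continuous hk ?_
    rintro _ ⟨b, rfl⟩
    exact ⟨a * b, by simp [L]⟩
  obtain ⟨k, hk, z, hz, hkz⟩ := K.exists_add_mem_mem_orthogonal ξ
  -- `K` and its orthogonal complement are both invariant, so `π a z` lies in both. Replacing `ξ` by
  -- its projection `k` therefore changes no `π a ξ`.
  have hπz : ∀ a, π a z = 0 := fun a => by
    have m1 : π a z ∈ K := by
      have : π a z = π a ξ - π a k := by rw [hkz, map_add]; abel
      rw [this]
      exact K.sub_mem (Lmem a) (inv a k hk)
    have m2 : π a z ∈ Kᗮ := fun u hu => by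
      rw [← inner_starHom_left]
      exact hz _ (inv _ u hu)
    exact inner_self_eq_zero.1 (m2 _ m1)
  have hπ : ∀ a, π a k = π a ξ := fun a => by rw [hkz, map_add, hπz, add_zero]
  refine ⟨H, _, _, ‹_›, π, k, fun a => ?_, ?_⟩
  · rw [hf, ← hπ, hkz, inner_add_left, (K.mem_orthogonal' z).1 hz _ (inv a k hk), add_zero]
  · simp only [hπ]
    exact hk

theorem IsRepresentable.isPositive {f : A →ₗ[ℂ] ℂ} (hf : IsRepresentable f) : IsPositive f := by
  obtain ⟨H, _, _, _, π, ξ, hf⟩ := hf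
  intro a
  rw [hf, inner_starHom_star_mul_self]
  exact Complex.zero_le_real.2 (sq_nonneg _)

theorem IsPositive.re_eq {k : A →ₗ[ℂ] ℂ} (hk : IsPositive k) (a : A) :
    (((k (star a * a)).re : ℝ) : ℂ) = k (star a * a) :=
  Complex.ext rfl (Complex.le_def.1 (hk a)).2

variable {I : LeftIdeal A}

/-- Cauchy-Schwarz against `ξ`. Together with admissibility below, this lets the existence theorem
be applied to restrictions of representable functionals. -/
theorem IsRepresentable.isHilbertBounded {f : A →ₗ[ℂ] ℂ} (hf : IsRepresentable f) :
    IsHilbertBounded (f.domRestrict I.toSubmodule) := by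
  obtain ⟨H, _, _, _, π, ξ, hf⟩ := hf
  refine ⟨‖ξ‖ ^ 2, sq_nonneg _, fun a => ?_⟩
  change ((‖f (a : A)‖ ^ 2 : ℝ) : ℂ) ≤ ((‖ξ‖ ^ 2 : ℝ) : ℂ) * f (star (a : A) * a)
  rw [hf (star (a : A) * a), inner_starHom_star_mul_self, hf]
  have := norm_inner_le_norm (𝕜 := ℂ) ξ (π a ξ)
  have h2 := pow_le_pow_left₀ (norm_nonneg _) this 2
  rw [mul_pow] at h2
  exact_mod_cast h2

theorem IsRepresentable.isAdmissible {f : A →ₗ[ℂ] ℂ} (hf : IsRepresentable f) :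
    IsAdmissible (f.domRestrict I.toSubmodule) := by
  obtain ⟨H, _, _, _, π, ξ, hf⟩ := hf
  refine fun x => ⟨‖π x‖ ^ 2, sq_nonneg _, fun a => ?_⟩
  change f (star (a : A) * star x * x * a) ≤ ((‖π x‖ ^ 2 : ℝ) : ℂ) * f (star (a : A) * a)
  have e : star (a : A) * star x * x * a = star (x * (a : A)) * (x * a) := by
    rw [star_mul, mul_assoc]
  rw [e, hf, hf, inner_starHom_star_mul_self, inner_starHom_star_mul_self, map_mul, mul_apply_eq_comp]
  have h2 := pow_le_pow_left₀ (norm_nonneg _) ((π x).le_opNorm (π a ξ)) 2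
  rw [mul_pow] at h2
  exact_mod_cast h2

end Representable

/-! ### GNS construction over a left ideal and the smallest extension -/

section Form

variable {A : Type u} [NonUnitalRing A] [StarRing A] [Module ℂ A] {I : LeftIdeal A}

/-- Positivity on a left ideal. -/
def IsPositiveOn (f : I.toSubmodule →ₗ[ℂ] ℂ) : Prop :=
  ∀ a : I.toSubmodule, 0 ≤ f (I.lmul (star (a : A)) a)

/-- The sesquilinear form `f (a⋆ b)` of a functional on a left ideal. -/
def form (f : I.toSubmodule →ₗ[ℂ] ℂ) (a b : I.toSubmodule) : ℂ := f (I.lmul (star (a : A)) b)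

theorem form_add_left (f : I.toSubmodule →ₗ[ℂ] ℂ) (a b c : I.toSubmodule) :
    form f (a + b) c = form f a c + form f b c := by
  rw [form, form, form, ← map_add]
  exact congrArg f (Subtype.ext (by simp [LeftIdeal.lmul, add_mul]))

theorem form_add_right (f : I.toSubmodule →ₗ[ℂ] ℂ) (a b c : I.toSubmodule) :
    form f a (b + c) = form f a b + form f a c := by
  rw [form, form, form, ← map_add]
  exact congrArg f (Subtype.ext (by simp [LeftIdeal.lmul, mul_add]))

theorem form_lmul (f : I.toSubmodule →ₗ[ℂ] ℂ) (x : A) (a b : I.toSubmodule) :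
    form f (I.lmul (star x) a) b = form f a (I.lmul x b) :=
  congrArg f (Subtype.ext (by simp [LeftIdeal.lmul, mul_assoc]))

/-- For `M > 0` one divides by `M`. For `M = 0` the bound forces `f = 0`, and it is used at the
element `a⋆ a` of the ideal. -/
theorem IsHilbertBounded.isPositiveOn {f : I.toSubmodule →ₗ[ℂ] ℂ} (hf : IsHilbertBounded f) :
    IsPositiveOn f := by
  obtain ⟨M, hM, hf⟩ := hf
  intro a
  rcases hM.eq_or_lt with h | h
  · have := hf (I.lmul (star (a : A)) a)
    rw [← h, Complex.ofReal_zero, zero_mul] at this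
    have h3 : ‖f (I.lmul (star (a : A)) a)‖ ^ 2 ≤ 0 := by exact_mod_cast this
    have h4 : f (I.lmul (star (a : A)) a) = 0 := by
      rw [← norm_eq_zero]; exact pow_eq_zero_iff two_ne_zero |>.1 (le_antisymm h3 (sq_nonneg _))
    exact h4.ge
  · have h0 : (0 : ℂ) ≤ M * f (I.lmul (star (a : A)) a) :=
      le_trans (Complex.zero_le_real.2 (sq_nonneg _)) (hf a)
    rw [Complex.le_def, Complex.re_ofReal_mul, Complex.im_ofReal_mul] at h0
    exact Complex.le_def.2 ⟨(mul_nonneg_iff_of_pos_left h).1 h0.1,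
      ((mul_eq_zero.1 h0.2.symm).resolve_left h.ne').symm⟩

theorem form_smul_left [IsScalarTower ℂ A A] [StarModule ℂ A]
    (f : I.toSubmodule →ₗ[ℂ] ℂ) (c : ℂ) (a b : I.toSubmodule) :
    form f (c • a) b = (starRingEnd ℂ) c * form f a b := by
  rw [form, form, ← smul_eq_mul, ← map_smul]
  exact congrArg f (Subtype.ext (by simp [LeftIdeal.lmul, smul_mul_assoc]))

theorem form_smul_right [SMulCommClass ℂ A A] (f : I.toSubmodule →ₗ[ℂ] ℂ) (c : ℂ) (a b : I.toSubmodule) :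
    form f a (c • b) = c * form f a b := by
  rw [form, form, ← smul_eq_mul, ← map_smul]
  exact congrArg f (Subtype.ext (by simp [LeftIdeal.lmul, mul_smul_comm]))

variable [IsScalarTower ℂ A A] [SMulCommClass ℂ A A] [StarModule ℂ A]

/-- Polarization: the form is real on the diagonal, in particular at `a + b` and `a + i b`. -/
theorem IsPositiveOn.conj_form {f : I.toSubmodule →ₗ[ℂ] ℂ} (hf : IsPositiveOn f)
    (a b : I.toSubmodule) : (starRingEnd ℂ) (form f b a) = form f a b := by
  have real : ∀ c, (form f c c).im = 0 := fun c => ((Complex.le_def.1 (hf c)).2).symm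
  have h1 := real (a + b)
  have h2 := real (a + Complex.I • b)
  simp only [form_add_left, form_add_right, form_smul_left, form_smul_right, Complex.add_im,
    real, Complex.mul_im, Complex.mul_re, Complex.add_re, Complex.conj_I, Complex.I_re, Complex.I_im, Complex.neg_re,
    Complex.neg_im] at h1 h2
  apply Complex.ext
  · simp only [Complex.conj_re]; linarith
  · simp only [Complex.conj_im]; linarith

/-- The pre-Hilbert structure on the left ideal given by `f (a⋆ b)`. -/
abbrev IsPositiveOn.core {f : I.toSubmodule →ₗ[ℂ] ℂ} (hf : IsPositiveOn f) :
    PreInnerProductSpace.Core ℂ I.toSubmodule where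
  inner := form f
  conj_inner_symm := hf.conj_form
  re_inner_nonneg a := (Complex.le_def.1 (hf a)).1
  add_left := form_add_left f
  smul_left a b c := form_smul_left f c a b

/-- The Cauchy-Schwarz inequality. -/
theorem IsPositiveOn.norm_form_sq_le {f : I.toSubmodule →ₗ[ℂ] ℂ} (hf : IsPositiveOn f)
    (a b : I.toSubmodule) : ‖form f a b‖ ^ 2 ≤ (form f a a).re * (form f b b).re := by
  have h := InnerProductSpace.Core.inner_mul_inner_self_le (c := hf.core) a b
  have e : ‖form f b a‖ = ‖form f a b‖ := by rw [← hf.conj_form a b, RCLike.norm_conj]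
  change ‖form f a b‖ * ‖form f b a‖ ≤ (form f a a).re * (form f b b).re at h
  rwa [e, ← sq] at h

/-- The GNS construction over a left ideal. -/
theorem exists_gns {f : I.toSubmodule →ₗ[ℂ] ℂ} (hadm : IsAdmissible f)
    (hbdd : IsHilbertBounded f) :
    ∃ (H : Type u) (_ : NormedAddCommGroup H) (_ : InnerProductSpace ℂ H) (_ : CompleteSpace H)
      (π : A →⋆ₙₐ[ℂ] (H →L[ℂ] H)) (j : I.toSubmodule → H) (ζ : H), DenseRange j ∧
      (∀ a b, ⟪j a, j b⟫_ℂ = form f a b) ∧ (∀ x a, π x (j a) = j (I.lmul x a)) ∧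
      ∀ a, ⟪ζ, j a⟫_ℂ = f a := by
  have hpos := hbdd.isPositiveOn
  let _ : SeminormedAddCommGroup I.toSubmodule :=
    InnerProductSpace.Core.toSeminormedAddCommGroup (c := hpos.core)
  let _ : InnerProductSpace ℂ I.toSubmodule := InnerProductSpace.ofCore hpos.core
  have hin : ∀ a b : I.toSubmodule, ⟪a, b⟫_ℂ = form f a b := fun a b => rfl
  have hnorm : ∀ a : I.toSubmodule, form f a a = ((‖a‖ ^ 2 : ℝ) : ℂ) := fun a => by
    rw [← hin, inner_self_eq_norm_sq_to_K]; norm_cast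
  let L : A → I.toSubmodule →ₗ[ℂ] I.toSubmodule := fun x =>
    { toFun := I.lmul x
      map_add' := fun a b => Subtype.ext (by simp [LeftIdeal.lmul, mul_add])
      map_smul' := fun c a => Subtype.ext (by simp [LeftIdeal.lmul, mul_smul_comm]) }
  obtain ⟨π, hπ⟩ := exists_starHom_completion L
    (fun x y a => Subtype.ext (by simp [L, LeftIdeal.lmul, add_mul]))
    (fun c x a => Subtype.ext (by simp [L, LeftIdeal.lmul, smul_mul_assoc]))
    (fun x y a => Subtype.ext (by simp [L, LeftIdeal.lmul, mul_assoc]))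
    (fun x a b => form_lmul f x a b)
    (fun x => by
      obtain ⟨c, hc, h⟩ := hadm x
      refine ⟨√c, fun a => ?_⟩
      have e : f (I.lmul (star (a : A) * star x * x) a) = form f (L x a) (L x a) :=
        congrArg f (Subtype.ext (by simp [L, LeftIdeal.lmul, mul_assoc]))
      have h1 := h a
      rw [e, show f (I.lmul (star (a : A)) a) = form f a a from rfl, hnorm, hnorm] at h1
      have h2 : ‖L x a‖ ^ 2 ≤ c * ‖a‖ ^ 2 := by exact_mod_cast h1
      refine le_of_sq_le_sq ?_ (by positivity)
      rwa [mul_pow, Real.sq_sqrt hc])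
  obtain ⟨M, hM, h⟩ := hbdd
  let φ : I.toSubmodule →L[ℂ] ℂ := f.mkContinuous (√M) fun a => by
    have h1 := h a
    rw [show f (I.lmul (star (a : A)) a) = form f a a from rfl, hnorm] at h1
    have h2 : ‖f a‖ ^ 2 ≤ M * ‖a‖ ^ 2 := by exact_mod_cast h1
    refine le_of_sq_le_sq ?_ (by positivity)
    rwa [mul_pow, Real.sq_sqrt hM]
  refine ⟨Completion I.toSubmodule, inferInstance, inferInstance, inferInstance, π,
    fun a => (a : Completion I.toSubmodule), (InnerProductSpace.toDual ℂ _).symm φ.fromCompletion,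
    Completion.denseRange_coe, fun a b => ?_, fun x a => hπ x a, fun a => ?_⟩
  · rw [Completion.inner_coe, hin]
  · rw [InnerProductSpace.toDual_symm_apply, ContinuousLinearMap.fromCompletion_apply_coe]
    rfl

/-- An admissible Hilbert bounded functional on a left ideal has a smallest representable
extension. -/
theorem exists_isLeast_repExtensions {f : I.toSubmodule →ₗ[ℂ] ℂ} (hadm : IsAdmissible f)
    (hbdd : IsHilbertBounded f) : ∃ F, IsLeast (repExtensions f) F := by
  have hpos := hbdd.isPositiveOn
  obtain ⟨H, _, _, _, π, j, ζ, hj, hform, hπ, hζ⟩ := exists_gns hadm hbdd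
  let F : A →ₗ[ℂ] ℂ :=
    { toFun := fun a => ⟪ζ, π a ζ⟫_ℂ
      map_add' := fun a b => by rw [map_add, add_apply, inner_add_right]
      map_smul' := fun c a => by
        rw [map_smul, smul_apply, inner_smul_right, RingHom.id_apply,
          smul_eq_mul] }
  have hjζ : ∀ x a, ⟪j a, π x ζ⟫_ℂ = (starRingEnd ℂ) (f (I.lmul (star x) a)) := fun x a => by
    rw [← inner_starHom_left, hπ, ← inner_conj_symm, hζ]
  -- Tested against the dense vectors `j b`, both sides give `f (b⋆ a)`, by hermitian symmetry of
  -- the form.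
  have hπζ : ∀ a : I.toSubmodule, π a ζ = j a := fun a => by
    refine hj.eq_of_inner_right ℂ fun b => ?_
    rw [hjζ, hform, ← hpos.conj_form]
    rfl
  refine ⟨⟨F, H, _, _, ‹_›, π, ζ, fun a => rfl⟩, fun a => ?_, fun G hG x => ?_⟩
  · change ⟪ζ, π a ζ⟫_ℂ = f a
    rw [hπζ, hζ]
  · obtain ⟨K, _, _, _, ρ, η, hη⟩ := G.2
    change 0 ≤ G.1 (star x * x) - ⟪ζ, π (star x * x) ζ⟫_ℂ
    rw [sub_nonneg, hη, inner_starHom_star_mul_self, inner_starHom_star_mul_self]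
    have hGf : ∀ a : I.toSubmodule, f a = ⟪η, ρ a η⟫_ℂ := fun a => by rw [← hη]; exact (hG a).symm
    -- Since `b⋆ b` lies in the ideal, every representable extension gives the same norm here.
    have hnorm : ∀ b : I.toSubmodule, ‖ρ b η‖ = ‖j b‖ := fun b => by
      have h1 : ⟪ρ b η, ρ b η⟫_ℂ = ⟪j b, j b⟫_ℂ := by
        rw [← inner_starHom_mul, hform, form, hGf]
        rfl
      rw [inner_self_eq_norm_sq_to_K, inner_self_eq_norm_sq_to_K] at h1
      have h2 : ‖ρ b η‖ ^ 2 = ‖j b‖ ^ 2 := by exact_mod_cast h1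
      exact (sq_eq_sq₀ (norm_nonneg _) (norm_nonneg _)).1 h2
    -- On `v = j b` the pairing is the conjugate of `f (x⋆ b) = ⟪ρ x η, ρ b η⟫`, so Cauchy-Schwarz
    -- applies; density gives all `v`. Taking `v = π x ζ` yields minimality.
    have hb : ∀ v : H, ‖⟪v, π x ζ⟫_ℂ‖ ≤ ‖ρ x η‖ * ‖v‖ := fun v => by
      refine hj.induction_on (p := fun v => ‖⟪v, π x ζ⟫_ℂ‖ ≤ ‖ρ x η‖ * ‖v‖) v
        (isClosed_le (by fun_prop) (by fun_prop)) fun b => ?_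
      rw [hjζ, RCLike.norm_conj, hGf, ← hnorm]
      change ‖⟪η, ρ (star x * b) η⟫_ℂ‖ ≤ _
      rw [inner_starHom_mul]
      exact norm_inner_le_norm _ _
    have h1 := hb (π x ζ)
    rw [inner_self_eq_norm_sq_to_K] at h1
    have h2 : ‖π x ζ‖ ^ 2 ≤ ‖ρ x η‖ * ‖π x ζ‖ := by simpa using h1
    have h3 : ‖π x ζ‖ ^ 2 ≤ ‖ρ x η‖ ^ 2 := by
      nlinarith [norm_nonneg (π x ζ), norm_nonneg (ρ x η), sq_nonneg (‖π x ζ‖ - ‖ρ x η‖)]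
    exact_mod_cast h3

theorem isLeast_kreinVonNeumann {f : I.toSubmodule →ₗ[ℂ] ℂ} (hadm : IsAdmissible f)
    (hbdd : IsHilbertBounded f) : IsLeast (repExtensions f) (kreinVonNeumann f) := by
  have h := exists_isLeast_repExtensions hadm hbdd
  rw [kreinVonNeumann, dif_pos h]
  exact h.choose_spec

end Form

/-! ### Differences of comparable representable functionals -/

section Difference

variable {A : Type u} [NonUnitalRing A] [StarRing A] [Module ℂ A]
  [IsScalarTower ℂ A A] [SMulCommClass ℂ A A] [StarModule ℂ A]

variable (A) in
/-- The whole algebra as a left ideal. -/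
def LeftIdeal.univ : LeftIdeal A :=
  { (⊤ : Submodule ℂ A) with mul_mem_left' := fun _ _ _ => trivial }

/-- An element of the algebra as an element of the left ideal `LeftIdeal.univ A`. -/
def LeftIdeal.toUniv (a : A) : (LeftIdeal.univ A).toSubmodule := ⟨a, trivial⟩

theorem IsPositive.norm_sq_le {k : A →ₗ[ℂ] ℂ} (hk : IsPositive k) (a b : A) :
    ‖k (star a * b)‖ ^ 2 ≤ (k (star a * a)).re * (k (star b * b)).re :=
  IsPositiveOn.norm_form_sq_le (I := LeftIdeal.univ A)
    (f := k.domRestrict (LeftIdeal.univ A).toSubmodule) (fun a => hk a)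
    (LeftIdeal.toUniv a) (LeftIdeal.toUniv b)

/-- With the whole algebra as the ideal, the only extension of `k` is `k` itself. -/
theorem isRepresentable_of_bounds {k : A →ₗ[ℂ] ℂ}
    (hadm : IsAdmissible (k.domRestrict (LeftIdeal.univ A).toSubmodule))
    (hbdd : IsHilbertBounded (k.domRestrict (LeftIdeal.univ A).toSubmodule)) :
    IsRepresentable k := by
  obtain ⟨F, hF, -⟩ := exists_isLeast_repExtensions hadm hbdd
  have : F.toFun = k := LinearMap.ext fun a => hF (LeftIdeal.toUniv a)
  exact this ▸ F.2

/-- A positive functional dominated by a representable one is admissible. -/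
theorem isAdmissible_of_le {G k : A →ₗ[ℂ] ℂ} (hG : IsRepresentable G) (hk : IsPositive k)
    (hkG : IsPositive (G - k)) :
    IsAdmissible (k.domRestrict (LeftIdeal.univ A).toSubmodule) := by
  obtain ⟨H, _, _, _, π, ξ, hG⟩ := hG
  intro x
  -- The summand 1 only serves to make `c` positive.
  obtain ⟨c, hc⟩ : ∃ c, c = ‖π (star x * x)‖ + 1 := ⟨_, rfl⟩
  have hc0 : 0 < c := by rw [hc]; positivity
  refine ⟨c, hc0.le, fun a' => ?_⟩
  obtain ⟨a, rfl⟩ : ∃ a, a' = LeftIdeal.toUniv a := ⟨a', rfl⟩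
  change k (star a * star x * x * a) ≤ (c : ℂ) * k (star a * a)
  -- `s n` is `(x⋆ x)^n a`. Cauchy-Schwarz for `k` makes `k (s n⋆ s n)` log-convex, and `k ≤ G`
  -- bounds its growth by `c ^ (2 n)`.
  let s : ℕ → A := fun n => (fun y => star x * x * y)^[n] a
  have hs : ∀ n, s (n + 1) = star x * x * s n := fun n => Function.iterate_succ_apply' _ _ _
  have hle : ∀ y, (k (star y * y)).re ≤ ‖π y ξ‖ ^ 2 := fun y => by
    have h := (Complex.le_def.1 (hkG y)).1
    rw [LinearMap.sub_apply, hG, inner_starHom_star_mul_self] at h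
    simp only [Complex.zero_re, Complex.sub_re, Complex.ofReal_re] at h
    linarith
  have hgrow : ∀ n, ‖π (s n) ξ‖ ≤ c ^ n * ‖π a ξ‖ := by
    intro n
    induction n with
    | zero => simp [s]
    | succ n ih =>
      rw [hs, map_mul, mul_apply_eq_comp, pow_succ', mul_assoc]
      refine ((π (star x * x)).le_opNorm _).trans ?_
      exact mul_le_mul (by rw [hc]; linarith) ih (norm_nonneg _) hc0.le
  have key := le_mul_of_logConvex_of_growth (q := fun n => (k (star (s n) * s n)).re)
    (C := ‖π a ξ‖ ^ 2) (c := c ^ 2) (by positivity)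
    (fun n => (Complex.le_def.1 (hk _)).1)
    (fun n => by
      have h := hk.norm_sq_le (s n) (s (n + 2))
      have e : star (s n) * s (n + 2) = star (s (n + 1)) * s (n + 1) := by
        rw [hs (n + 1), hs n]; simp only [star_mul, star_star, mul_assoc]
      rw [e, ← hk.re_eq, Complex.norm_real, Real.norm_eq_abs, sq_abs] at h
      exact h)
    (fun n => by
      refine (hle _).trans ((pow_le_pow_left₀ (norm_nonneg _) (hgrow n) 2).trans_eq ?_)
      ring)
  have e : star a * star x * x * a = star (x * a) * (x * a) := by
    rw [star_mul]; simp only [mul_assoc]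
  have e' : star a * star x * x * a = star (s 0) * s 1 := by
    rw [hs 0]; simp only [s, Function.iterate_zero, id, mul_assoc]
  have h := hk.norm_sq_le (s 0) (s 1)
  rw [← e', e, ← hk.re_eq, Complex.norm_real, Real.norm_eq_abs, sq_abs] at h
  have h0 : 0 ≤ (k (star a * a)).re := (Complex.le_def.1 (hk a)).1
  -- One more Cauchy-Schwarz, between `a` and `x⋆ x a`, turns the factor `c ^ 2` of `key` into `c`.
  have h2 : (k (star (x * a) * (x * a))).re ≤ c * (k (star a * a)).re := by
    refine le_of_sq_le_sq ?_ (by positivity)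
    refine h.trans ((mul_le_mul_of_nonneg_left key h0).trans_eq ?_)
    simp only [s, Function.iterate_zero, id]
    ring
  rw [e, ← hk.re_eq, ← hk.re_eq a]
  exact_mod_cast h2

/-- The difference of two comparable representable functionals is Hilbert bounded. -/
theorem isHilbertBounded_sub {F G : A →ₗ[ℂ] ℂ} (hF : IsRepresentable F) (hG : IsRepresentable G)
    (h : IsPositive (G - F)) :
    IsHilbertBounded ((G - F).domRestrict (LeftIdeal.univ A).toSubmodule) := by
  have hFpos := hF.isPositive
  obtain ⟨H, _, _, _, π, ξ, hG, hξ⟩ := hG.exists_cyclic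
  obtain ⟨K, _, _, _, ρ, ζ, hF⟩ := hF
  have hGn : ∀ y, G (star y * y) = ((‖π y ξ‖ ^ 2 : ℝ) : ℂ) := fun y => by
    rw [hG, inner_starHom_star_mul_self]
  have hFn : ∀ y, F (star y * y) = ((‖ρ y ζ‖ ^ 2 : ℝ) : ℂ) := fun y => by
    rw [hF, inner_starHom_star_mul_self]
  have hle : ∀ y, ‖ρ y ζ‖ ≤ ‖π y ξ‖ := fun y => by
    have h1 := h y
    rw [LinearMap.sub_apply, sub_nonneg, hGn, hFn] at h1
    exact le_of_sq_le_sq (by exact_mod_cast h1) (norm_nonneg _)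
  obtain ⟨v, hv, hlim⟩ := mem_closure_iff_seq_limit.1 hξ
  choose b hb using hv
  replace hlim : Tendsto (fun n => π (b n) ξ) atTop (𝓝 ξ) := by
    refine hlim.congr fun n => (hb n).symm
  refine ⟨‖ξ‖ ^ 2, sq_nonneg _, fun a' => ?_⟩
  obtain ⟨a, rfl⟩ : ∃ a, a' = LeftIdeal.toUniv a := ⟨a', rfl⟩
  change ((‖(G - F) a‖ ^ 2 : ℝ) : ℂ) ≤ ((‖ξ‖ ^ 2 : ℝ) : ℂ) * (G - F) (star a * a)
  have limG : Tendsto (fun n => G (star (b n) * a)) atTop (𝓝 (G a)) := by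
    simp only [hG, inner_starHom_mul]
    exact hlim.inner tendsto_const_nhds
  have limF : Tendsto (fun n => F (star (b n) * a)) atTop (𝓝 (F a)) := by
    -- Convergence of `ρ (b n) ζ` to `ζ` is not available. Moving `a` to the left puts the error in
    -- the form `ρ y ζ` with `y` in `A`, which `F ≤ G` bounds by `‖π y ξ‖`.
    have e : ∀ n, F (star (b n) * a) - F a = ⟪ρ (star a * b n - star a) ζ, ζ⟫_ℂ := fun n => by
      rw [map_sub ρ, sub_apply, inner_sub_left, inner_starHom_left, map_mul ρ,
        mul_apply_eq_comp, inner_starHom_left, hF, hF, inner_starHom_mul]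
    have e2 : ∀ n, π (star a * b n - star a) ξ = π (star a) (π (b n) ξ - ξ) := fun n => by
      rw [map_sub, sub_apply, map_mul, mul_apply_eq_comp, map_sub]
    rw [tendsto_iff_norm_sub_tendsto_zero]
    have hz : Tendsto (fun n => ‖π (star a) (π (b n) ξ - ξ)‖ * ‖ζ‖) atTop (𝓝 0) := by
      have h0 : Tendsto (fun n => π (b n) ξ - ξ) atTop (𝓝 0) := by
        simpa using hlim.sub_const ξ
      have h1 := (((π (star a)).continuous.tendsto 0).comp h0).norm.mul_const ‖ζ‖
      simpa using h1
    refine squeeze_zero (fun _ => norm_nonneg _) (fun n => ?_) hz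
    rw [e, ← e2]
    exact (norm_inner_le_norm _ _).trans
      (mul_le_mul_of_nonneg_right (hle _) (norm_nonneg _))
  have lim1 : Tendsto (fun n => ‖(G - F) (star (b n) * a)‖ ^ 2) atTop (𝓝 (‖(G - F) a‖ ^ 2)) :=
    (limG.sub limF).norm.pow 2
  have lim2 : Tendsto (fun n => ‖π (b n) ξ‖ ^ 2 * ((G - F) (star a * a)).re) atTop
      (𝓝 (‖ξ‖ ^ 2 * ((G - F) (star a * a)).re)) := (hlim.norm.pow 2).mul_const _
  -- Cauchy-Schwarz for `G - F` at `b n` and `a`, with `(G - F) (b⋆ b) ≤ G (b⋆ b)`, passed to the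
  -- limit.
  have key := le_of_tendsto_of_tendsto' lim1 lim2 fun n => by
    refine (h.norm_sq_le (b n) a).trans (mul_le_mul_of_nonneg_right ?_ (Complex.le_def.1 (h a)).1)
    have h1 := (Complex.le_def.1 (hFpos (b n))).1
    rw [LinearMap.sub_apply, Complex.sub_re, hGn (b n), Complex.ofReal_re]
    simp only [Complex.zero_re] at h1
    linarith
  rw [← h.re_eq]
  exact_mod_cast key

/-- The difference of two comparable representable functionals is representable. -/
theorem isRepresentable_sub {F G : A →ₗ[ℂ] ℂ} (hF : IsRepresentable F) (hG : IsRepresentable G)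
    (h : IsPositive (G - F)) : IsRepresentable (G - F) :=
  isRepresentable_of_bounds
    (isAdmissible_of_le hG h (by rw [sub_sub_cancel]; exact hF.isPositive))
    (isHilbertBounded_sub hF hG h)

/-- The difference `G - F` of representable functionals with `F ≤ G`. -/
def Rep.sub {F G : Rep A} (h : F ≤ G) : Rep A :=
  ⟨G.toFun - F.toFun, isRepresentable_sub F.2 G.2 h⟩

theorem Rep.toFun_sub {F G : Rep A} (h : F ≤ G) : (Rep.sub h).toFun = G.toFun - F.toFun := rfl

theorem Rep.le_def {F G : Rep A} : F ≤ G ↔ IsPositive (G.toFun - F.toFun) := Iff.rfl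

/-- If `F ≤ G ≤ K` and `F`, `K` both extend `f`, then so does `G`. -/
theorem mem_repExtensions_of_mem_Icc {I : LeftIdeal A} {f : I.toSubmodule →ₗ[ℂ] ℂ}
    {F G K : Rep A} (hF : F ∈ repExtensions f) (hK : K ∈ repExtensions f) (hFG : F ≤ G)
    (hGK : G ≤ K) : G ∈ repExtensions f := by
  intro a
  obtain ⟨M, -, h⟩ := (Rep.sub hFG).2.isHilbertBounded (I := I)
  have hFa := hF (I.lmul (star (a : A)) a)
  have hKa := hK (I.lmul (star (a : A)) a)
  have h1 := hFG a
  have h2 := hGK a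
  change F.toFun (star (a : A) * a) = _ at hFa
  change K.toFun (star (a : A) * a) = _ at hKa
  rw [LinearMap.sub_apply, sub_nonneg, hFa] at h1
  rw [LinearMap.sub_apply, sub_nonneg, hKa] at h2
  have h3 : (Rep.sub hFG).toFun (star (a : A) * a) = 0 := by
    rw [Rep.toFun_sub, LinearMap.sub_apply, hFa, sub_eq_zero]
    exact le_antisymm h2 h1
  have h4 : ((‖(Rep.sub hFG).toFun a‖ ^ 2 : ℝ) : ℂ) ≤
    M * (Rep.sub hFG).toFun (star (a : A) * a) := h a
  rw [h3, mul_zero] at h4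
  have h5 : ‖(Rep.sub hFG).toFun a‖ ^ 2 ≤ 0 := by exact_mod_cast h4
  have h6 : (Rep.sub hFG).toFun a = 0 := norm_eq_zero.1
    (pow_eq_zero_iff two_ne_zero |>.1 (le_antisymm h5 (sq_nonneg _)))
  rw [Rep.toFun_sub, LinearMap.sub_apply, sub_eq_zero] at h6
  rw [h6, hF]

end Difference

end StarAlg

end

/-! ### The extensions below `g` -/

/-- The first two conclusions say that the two Krein-von Neumann extensions that occur,
of `f` and of `g - f` on the ideal, do exist. -/
theorem theorem5p4 {A : Type u} [NonUnitalRing A] [StarRing A] [Module ℂ A]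
    [IsScalarTower ℂ A A] [SMulCommClass ℂ A A] [StarModule ℂ A]
    (I : StarAlg.LeftIdeal A) (f : I.toSubmodule →ₗ[ℂ] ℂ)
    (hadm : StarAlg.IsAdmissible f) (hbdd : StarAlg.IsHilbertBounded f)
    (g : StarAlg.Rep A) (hg : StarAlg.kreinVonNeumann f ≤ g) :
    IsLeast (StarAlg.repExtensions f) (StarAlg.kreinVonNeumann f) ∧
    IsLeast (StarAlg.repExtensions (g.toFun.domRestrict I.toSubmodule - f))
      (StarAlg.kreinVonNeumann (g.toFun.domRestrict I.toSubmodule - f)) ∧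
    ∃ fmax : StarAlg.Rep A,
      fmax.toFun = g.toFun -
        (StarAlg.kreinVonNeumann (g.toFun.domRestrict I.toSubmodule - f)).toFun ∧
      IsGreatest {F : StarAlg.Rep A | F ≤ g ∧ F ∈ StarAlg.repExtensions f} fmax ∧
      Set.Icc (StarAlg.kreinVonNeumann f) fmax =
        {F : StarAlg.Rep A | F ≤ g ∧ F ∈ StarAlg.repExtensions f} := by
  have hf := StarAlg.isLeast_kreinVonNeumann hadm hbdd
  have hsub : ∀ (F : StarAlg.Rep A) (h : F ≤ g), F ∈ StarAlg.repExtensions f →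
      StarAlg.Rep.sub h ∈ StarAlg.repExtensions (g.toFun.domRestrict I.toSubmodule - f) := by
    intro F h hF a
    rw [StarAlg.Rep.toFun_sub, LinearMap.sub_apply, hF a]
    rfl
  have hrestr : (StarAlg.Rep.sub hg).toFun.domRestrict I.toSubmodule =
      g.toFun.domRestrict I.toSubmodule - f := LinearMap.ext (hsub _ hg hf.1)
  have hN := StarAlg.isLeast_kreinVonNeumann
    (hrestr ▸ (StarAlg.Rep.sub hg).2.isAdmissible (I := I))
    (hrestr ▸ (StarAlg.Rep.sub hg).2.isHilbertBounded (I := I))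
  generalize StarAlg.kreinVonNeumann (g.toFun.domRestrict I.toSubmodule - f) = N at hN ⊢
  generalize StarAlg.kreinVonNeumann f = fN at hg hf hrestr hN ⊢
  have hsub_le : ∀ (F : StarAlg.Rep A) (h : F ≤ g), StarAlg.Rep.sub h ≤ g := by
    intro F h
    rw [StarAlg.Rep.le_def, StarAlg.Rep.toFun_sub, sub_sub_cancel]
    exact F.2.isPositive
  -- `g - f_N` is a representable extension of `g - f`, so `N ≤ g - f_N ≤ g`.
  have hNg : N ≤ g := (hN.2 (hsub fN hg hf.1)).trans (hsub_le fN hg)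
  have hmem : StarAlg.Rep.sub hNg ∈ StarAlg.repExtensions f := by
    intro a
    rw [StarAlg.Rep.toFun_sub, LinearMap.sub_apply, hN.1 a]
    exact sub_sub_cancel _ _
  have hmax : ∀ F : StarAlg.Rep A, F ≤ g → F ∈ StarAlg.repExtensions f →
      F ≤ StarAlg.Rep.sub hNg := by
    intro F h hF
    have := hN.2 (hsub F h hF)
    rw [StarAlg.Rep.le_def, StarAlg.Rep.toFun_sub] at this ⊢
    rwa [sub_right_comm]
  refine ⟨hf, hN, StarAlg.Rep.sub hNg, rfl,
    ⟨⟨hsub_le N hNg, hmem⟩, fun F hF => hmax F hF.1 hF.2⟩,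
    Set.ext fun F => ⟨fun hF => ?_, fun hF => ?_⟩⟩
  · exact ⟨hF.2.trans (hsub_le N hNg),
      StarAlg.mem_repExtensions_of_mem_Icc hf.1 hmem hF.1 hF.2⟩
  · exact ⟨hf.2 hF.2, hmax F hF.1 hF.2⟩
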